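/- Let $(M,g)$ be a smooth $n$-dimensional Riemannian manifold, with Christoffel symbols $\Gamma^h_{ki}$ in local coordinates $(x^i)$, and let $(x^i,y^i)$ be the induced local coordinates on the tangent bundle $TM$. Put $g_{0i}=y^kg_{ki}$, $t=\tfrac12 g_{ik}y^iy^k$ and $$\frac{\delta}{\delta x^i}=\frac{\partial}{\partial x^i}-y^k\Gamma^h_{ki}\frac{\partial}{\partial y^h}.$$ Let $c_1,c_2,c_3,d_1,d_2,d_3:[0,\infty)\to\mathbb R$ be smooth functions and let $G$ be the general natural lifted metric on $TM$ which they define, i.e. in every induced local chart $$G\Big(\frac{\delta}{\delta x^i},\frac{\delta}{\delta x^j}\Big)=c_1(t)g_{ij}+d_1(t)g_{0i}g_{0j},\qquad G\Big(\frac{\partial}{\partial y^i},\frac{\partial}{\partial y^j}\Big)=c_2(t)g_{ij}+d_2(t)g_{0i}g_{0j},$$ $$G\Big(\frac{\partial}{\partial y^i},\frac{\delta}{\delta x^j}\Big)=G\Big(\frac{\delta}{\delta x^i},\frac{\partial}{\partial y^j}\Big)=c_3(t)g_{ij}+d_3(t)g_{0i}g_{0j}.$$ Assume that $G$ is non-degenerate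 at every point of $TM$ (for instance, that $G$ is a Riemannian metric). If $(TM,G)$ has constant sectional curvature, i.e. there is a real number $k$ such that every tangent plane of $TM$ on which $G$ is non-degenerate has sectional curvature $k$, then $(M,g)$ is flat, i.e. the curvature tensor of $g$ vanishes identically. -/

import Mathlib

open scoped Manifold ContDiff

noncomputable section

namespace LocalMetric

variable {E : Type*} [NormedAddCommGroup E] [NormedSpace ℝ E]

/-- Christoffel map of a field `h` of bilinear forms on an open part of the vector space `E`:
`christoffel h z v w` is the vector with components `Γ^k_{ij}(z) v^i w^j`, i.e. the solution `Γ` of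
`2 h(Γ, u) = (D_v h)(w, u) + (D_w h)(v, u) - (D_u h)(v, w)` for all `u`, obtained with the inverse
of the linear map `h z : E → E*` (which exists wherever `h z` is non-degenerate, if
`dim E < ∞`). -/
def christoffel (h : E → E →L[ℝ] E →L[ℝ] ℝ) (z v w : E) : E :=
  (h z).inverse ((1 / 2 : ℝ) •
    (fderiv ℝ h z v w + fderiv ℝ h z w v - ((fderiv ℝ h z).flip v).flip w))

/-- Curvature of the Levi-Civita connection of `h`, for constant vector fields `u`, `v`, `w` on
`E`: `R(u,v)w = ∇_u ∇_v w - ∇_v ∇_u w`, where `∇_u Y = D_u Y + Γ(u, Y)`. -/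
def curvature (h : E → E →L[ℝ] E →L[ℝ] ℝ) (z u v w : E) : E :=
  fderiv ℝ (fun z' => christoffel h z' v w) z u
    - fderiv ℝ (fun z' => christoffel h z' u w) z v
    + christoffel h z u (christoffel h z v w)
    - christoffel h z v (christoffel h z u w)

/-- The Gram determinant of `v` and `w`; non-zero iff `v`, `w` span a plane on which `h z` is
non-degenerate. For positive definite `h z` this means that `v`, `w` are linearly independent. -/
def gram (h : E → E →L[ℝ] E →L[ℝ] ℝ) (z v w : E) : ℝ :=
  h z v v * h z w w - h z v w * h z v w

/-- Sectional curvature of the plane spanned by `v` and `w` (meaningful if `gram h z v w ≠ 0`). -/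
def sectionalCurvature (h : E → E →L[ℝ] E →L[ℝ] ℝ) (z v w : E) : ℝ :=
  h z (curvature h z v w w) v / gram h z v w

end LocalMetric

section Manifolds

variable {E : Type*} [NormedAddCommGroup E] [NormedSpace ℝ E]
  {H : Type*} [TopologicalSpace H] (I : ModelWithCorners ℝ E H)
  {N : Type*} [TopologicalSpace N] [ChartedSpace H N]

/-- Components of a field `B` of bilinear forms on the tangent spaces of `N`, in the chart `φ`
around `p`: the form on `E` with value `B (∂_v, ∂_w)` at `(v, w)`, at the point `φ⁻¹ z`, where
`∂_v = dφ⁻¹(v)`. Used for `z` in the target of `φ`, on manifolds without boundary. (In Mathlib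
each `TangentSpace I q` is a copy of `E`, so that `dφ⁻¹` and `B q` can be read as maps on `E`.) -/
def metricInChart (B : ∀ q : N, TangentSpace I q →L[ℝ] TangentSpace I q →L[ℝ] ℝ)
    (p : N) (z : E) : E →L[ℝ] E →L[ℝ] ℝ :=
  letI A : E →L[ℝ] E := mfderiv 𝓘(ℝ, E) I (extChartAt I p).symm z
  letI b : E →L[ℝ] E →L[ℝ] ℝ := B ((extChartAt I p).symm z)
  b.bilinearComp A A

/-- The (pseudo-)Riemannian metric `B` on `N` is flat: its curvature tensor vanishes
(in the charts around all points, on the whole chart domains). -/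
def IsFlatMetric (B : ∀ q : N, TangentSpace I q →L[ℝ] TangentSpace I q →L[ℝ] ℝ) : Prop :=
  ∀ p : N, ∀ z ∈ (extChartAt I p).target, ∀ u v w : E,
    LocalMetric.curvature (metricInChart I B p) z u v w = 0

/-- The (pseudo-)Riemannian metric `B` on `N` has constant sectional curvature: there is a real
number `k` which is the sectional curvature of every non-degenerate tangent plane, at every
point. -/
def HasConstantSectionalCurvature
    (B : ∀ q : N, TangentSpace I q →L[ℝ] TangentSpace I q →L[ℝ] ℝ) : Prop :=
  ∃ k : ℝ, ∀ p : N, ∀ z ∈ (extChartAt I p).target, ∀ v w : E,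
    LocalMetric.gram (metricInChart I B p) z v w ≠ 0 →
      LocalMetric.sectionalCurvature (metricInChart I B p) z v w = k

end Manifolds

section TangentBundles

variable {E : Type*} [NormedAddCommGroup E] [NormedSpace ℝ E]

/-- The vector with components `v` in the local frame `∂/∂yⁱ` of the vertical distribution,
written in the induced chart `(x, y)` of the tangent bundle. -/
def verticalFrame (v : E) : E × E := (0, v)

/-- The vector with components `v` in the local frame `δ/δxⁱ = ∂/∂xⁱ - y^k Γ^h_{ki} ∂/∂y^h` of the
horizontal distribution at the point `(x, y)`, written in the induced chart of the tangent
bundle; `h` is the metric of the base manifold in the corresponding chart. -/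
def horizontalFrame (h : E → E →L[ℝ] E →L[ℝ] ℝ) (x y v : E) : E × E :=
  (v, -LocalMetric.christoffel h x y v)

variable {M : Type*} [TopologicalSpace M] [ChartedSpace E M] [IsManifold 𝓘(ℝ, E) ∞ M]

/-- `G`, a field of bilinear forms on the tangent spaces of the tangent bundle `TM`, is the general
natural lift of the Riemannian metric `g` of `M` for some smooth functions `c₁, …, d₃` on `[0, ∞)`
of the energy density `t = g(y, y) / 2`. The chart of `TM` around `a` is the chart `(x, y)` induced
from the chart of `M` around the base point of `a`, so that its domain consists of
all `(x, y)` with `x` in the target of the latter. -/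
def IsGeneralNaturalLift
    (g : Bundle.ContMDiffRiemannianMetric 𝓘(ℝ, E) ∞ E (fun x : M => TangentSpace 𝓘(ℝ, E) x))
    (G : ∀ a : TangentBundle 𝓘(ℝ, E) M,
      TangentSpace (𝓘(ℝ, E).tangent) a →L[ℝ] TangentSpace (𝓘(ℝ, E).tangent) a →L[ℝ] ℝ) : Prop :=
  ∃ c₁ c₂ c₃ d₁ d₂ d₃ : ℝ → ℝ,
    ContDiffOn ℝ ∞ c₁ (Set.Ici 0) ∧ ContDiffOn ℝ ∞ c₂ (Set.Ici 0) ∧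
    ContDiffOn ℝ ∞ c₃ (Set.Ici 0) ∧ ContDiffOn ℝ ∞ d₁ (Set.Ici 0) ∧
    ContDiffOn ℝ ∞ d₂ (Set.Ici 0) ∧ ContDiffOn ℝ ∞ d₃ (Set.Ici 0) ∧
    ∀ (a : TangentBundle 𝓘(ℝ, E) M), ∀ x ∈ (extChartAt 𝓘(ℝ, E) a.proj).target, ∀ y v w : E,
      letI h : E → E →L[ℝ] E →L[ℝ] ℝ := metricInChart 𝓘(ℝ, E) g.inner a.proj
      letI Gxy : E × E →L[ℝ] E × E →L[ℝ] ℝ := metricInChart (𝓘(ℝ, E).tangent) G a (x, y)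
      letI t : ℝ := (1 / 2) * h x y y
      Gxy (horizontalFrame h x y v) (horizontalFrame h x y w)
          = c₁ t * h x v w + d₁ t * (h x y v * h x y w) ∧
        Gxy (verticalFrame v) (verticalFrame w)
          = c₂ t * h x v w + d₂ t * (h x y v * h x y w) ∧
        Gxy (verticalFrame v) (horizontalFrame h x y w)
          = c₃ t * h x v w + d₃ t * (h x y v * h x y w) ∧
        Gxy (horizontalFrame h x y v) (verticalFrame w)
          = c₃ t * h x v w + d₃ t * (h x y v * h x y w)

end TangentBundles

end

/-! Everything happens along the zero section of `TM`, in an induced chart, where the lift of `h` is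
called `K`. At `(x, 0)` the terms with `d₁, d₂, d₃` disappear and, to first order, `c₁, c₂, c₃` are
the constants `c₁ 0, c₂ 0, c₃ 0`. The Koszul formula then gives `Γ((u,0),(0,w)) = (0, Γ(u,w))`
(`christoffel_zeroSection`). Horizontal directions are tangent to the zero section, so this identity
can be differentiated along them: `R((u,0),(v,0))(0,w) = (0, R(u,v)w)` (`curvature_zeroSection`).

Constant sectional curvature, on the other hand, forces `R(U,V)W = k (K(V,W) U - K(U,W) V)`
(`curvature_eq_of_sectionalCurvature_eq`), which for `U = (u,0)`, `V = (v,0)` has no vertical part.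
Hence `R(u,v)w = 0`.

Since `K` may be indefinite, the sectional curvature is known only on non-degenerate planes. One
such plane exists at `(x, 0)` (`exists_gram_ne_zero`), and density and continuity handle the others.
-/

/-! ### Levi-Civita calculus of a pseudo-Riemannian metric on an open set. -/

namespace LocalMetric

open ContinuousLinearMap

variable {E : Type*} [NormedAddCommGroup E] [NormedSpace ℝ E]

/-- `h` is a smooth pseudo-Riemannian metric on the open set `s` of the vector space `E`. -/
structure IsMetricOn (h : E → E →L[ℝ] E →L[ℝ] ℝ) (s : Set E) : Prop where
  isOpen : IsOpen s
  contDiffOn : ContDiffOn ℝ ∞ h s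
  symm : ∀ z ∈ s, ∀ v w, h z v w = h z w v
  isInvertible : ∀ z ∈ s, (h z).IsInvertible

theorem christoffel_add_left (h : E → E →L[ℝ] E →L[ℝ] ℝ) (z v v' w : E) :
    christoffel h z (v + v') w = christoffel h z v w + christoffel h z v' w := by
  rw [christoffel, christoffel, christoffel, ← map_add, ← smul_add]
  congr 2
  simp only [map_add, add_apply, flip_add]
  abel

theorem christoffel_add_right (h : E → E →L[ℝ] E →L[ℝ] ℝ) (z v w w' : E) :
    christoffel h z v (w + w') = christoffel h z v w + christoffel h z v w' := by
  rw [christoffel, christoffel, christoffel, ← map_add, ← smul_add]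
  congr 2
  simp only [map_add, add_apply]
  abel

theorem christoffel_smul_left (h : E → E →L[ℝ] E →L[ℝ] ℝ) (z v w : E) (a : ℝ) :
    christoffel h z (a • v) w = a • christoffel h z v w := by
  rw [christoffel, christoffel, ← map_smul, smul_comm a]
  simp only [map_smul, FunLike.coe_smul, Pi.smul_apply, smul_add, smul_sub, flip_smul]

theorem christoffel_smul_right (h : E → E →L[ℝ] E →L[ℝ] ℝ) (z v w : E) (a : ℝ) :
    christoffel h z v (a • w) = a • christoffel h z v w := by
  simp only [christoffel, map_smul, FunLike.coe_smul, Pi.smul_apply, ← smul_add, ← smul_sub,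
    smul_comm a (1 / 2 : ℝ)]

@[simp]
theorem christoffel_zero_left (h : E → E →L[ℝ] E →L[ℝ] ℝ) (z w : E) :
    christoffel h z 0 w = 0 := by
  simpa using christoffel_smul_left h z 0 w 0

@[simp]
theorem christoffel_zero_right (h : E → E →L[ℝ] E →L[ℝ] ℝ) (z v : E) :
    christoffel h z v 0 = 0 := by
  simpa using christoffel_smul_right h z v 0 0

theorem curvature_swap (h : E → E →L[ℝ] E →L[ℝ] ℝ) (z u v w : E) :
    curvature h z v u w = -curvature h z u v w := by
  simp only [curvature]
  abel

namespace IsMetricOn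

variable {h : E → E →L[ℝ] E →L[ℝ] ℝ} {s : Set E} {z : E}

theorem contDiffAt (hm : IsMetricOn h s) (hz : z ∈ s) : ContDiffAt ℝ ∞ h z :=
  hm.contDiffOn.contDiffAt (hm.isOpen.mem_nhds hz)

theorem differentiableAt (hm : IsMetricOn h s) (hz : z ∈ s) : DifferentiableAt ℝ h z :=
  (hm.contDiffAt hz).differentiableAt (by simp)

theorem eventually_mem (hm : IsMetricOn h s) (hz : z ∈ s) : ∀ᶠ z' in nhds z, z' ∈ s :=
  hm.isOpen.mem_nhds hz

/-- The Koszul formula. -/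
theorem two_mul_apply_christoffel (hm : IsMetricOn h s) (hz : z ∈ s) (v w u : E) :
    2 * h z (christoffel h z v w) u
      = fderiv ℝ h z v w u + fderiv ℝ h z w v u - fderiv ℝ h z u v w := by
  rw [christoffel, (hm.isInvertible z hz).self_apply_inverse]
  simp

theorem eq_of_apply_eq (hm : IsMetricOn h s) (hz : z ∈ s) {v w : E}
    (e : ∀ u, h z v u = h z w u) : v = w :=
  (hm.isInvertible z hz).injective (ContinuousLinearMap.ext e)

/-- Uniqueness in the Koszul formula; it allows a guessed Christoffel vector to be verified without
inverting `h z`. -/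
theorem christoffel_eq (hm : IsMetricOn h s) (hz : z ∈ s) {v w c : E}
    (e : ∀ u, 2 * h z c u
      = fderiv ℝ h z v w u + fderiv ℝ h z w v u - fderiv ℝ h z u v w) :
    christoffel h z v w = c :=
  hm.eq_of_apply_eq hz fun u => by
    have := hm.two_mul_apply_christoffel hz v w u
    have := e u
    linarith

theorem fderiv_apply_apply (hm : IsMetricOn h s) (hz : z ∈ s) (u v w : E) :
    fderiv ℝ (fun z' => h z' v w) z u = fderiv ℝ h z u v w := by
  have := ((hm.differentiableAt hz).hasFDerivAt.clm_apply (hasFDerivAt_const v z)).clm_apply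
    (hasFDerivAt_const w z)
  rw [this.fderiv]
  simp

theorem fderiv_symm (hm : IsMetricOn h s) (hz : z ∈ s) (u v w : E) :
    fderiv ℝ h z u v w = fderiv ℝ h z u w v := by
  rw [← hm.fderiv_apply_apply hz, ← hm.fderiv_apply_apply hz]
  congr 1
  apply Filter.EventuallyEq.fderiv_eq
  filter_upwards [hm.eventually_mem hz] with z' hz' using hm.symm z' hz' v w

theorem christoffel_symm (hm : IsMetricOn h s) (hz : z ∈ s) (v w : E) :
    christoffel h z v w = christoffel h z w v :=
  hm.christoffel_eq hz fun u => by
    rw [hm.two_mul_apply_christoffel hz, hm.fderiv_symm hz u v w]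
    ring

/-- The Levi-Civita connection is metric. -/
theorem fderiv_eq (hm : IsMetricOn h s) (hz : z ∈ s) (u v w : E) :
    fderiv ℝ h z u v w = h z (christoffel h z u v) w + h z v (christoffel h z u w) := by
  have h1 := hm.two_mul_apply_christoffel hz u v w
  have h2 := hm.two_mul_apply_christoffel hz u w v
  rw [hm.symm z hz v]
  have h3 := hm.fderiv_symm hz u v w
  have h4 := hm.fderiv_symm hz v u w
  have h5 := hm.fderiv_symm hz w u v
  linarith

/-- The first Bianchi identity. -/
theorem curvature_cyclic (hm : IsMetricOn h s) (hz : z ∈ s) (u v w : E) :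
    curvature h z u v w + curvature h z v w u + curvature h z w u v = 0 := by
  have e (a b : E) : fderiv ℝ (fun z' => christoffel h z' a b) z
      = fderiv ℝ (fun z' => christoffel h z' b a) z := by
    apply Filter.EventuallyEq.fderiv_eq
    filter_upwards [hm.eventually_mem hz] with z' hz' using hm.christoffel_symm hz' a b
  simp only [curvature]
  rw [e w u, e v u, e w v, hm.christoffel_symm hz w u, hm.christoffel_symm hz v u,
    hm.christoffel_symm hz w v]
  abel

variable [FiniteDimensional ℝ E]

-- Base point and arguments vary together because the lifted metric contains `christoffel h x y v`
-- as a function of `(x, y)`. Smoothness comes from that of operator inversion at an invertible map.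
set_option maxSynthPendingDepth 3 in
theorem contDiffAt_christoffel (hm : IsMetricOn h s) {F : Type*} [NormedAddCommGroup F]
    [NormedSpace ℝ F] {f v w : F → E} {a : F} (hz : f a ∈ s) (hf : ContDiffAt ℝ ∞ f a)
    (hv : ContDiffAt ℝ ∞ v a) (hw : ContDiffAt ℝ ∞ w a) :
    ContDiffAt ℝ ∞ (fun b => christoffel h (f b) (v b) (w b)) a := by
  have hc : CompleteSpace E := FiniteDimensional.complete ℝ E
  have hd : ContDiffAt ℝ ∞ (fun b => fderiv ℝ h (f b)) a :=
    ((hm.contDiffAt hz).fderiv_right (m := ∞) (by simp)).comp a hf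
  have hi : ContDiffAt ℝ ∞ (fun b => (h (f b)).inverse) a := by
    obtain ⟨e, he⟩ := hm.isInvertible (f a) hz
    have := contDiffAt_map_inverse (𝕜 := ℝ) (n := ∞) e
    rw [he] at this
    exact this.comp (f := fun b => h (f b)) a ((hm.contDiffAt hz).comp a hf)
  have hl : ContDiffAt ℝ ∞ (fun b => ((fderiv ℝ h (f b)).flip (v b)).flip (w b)) a := by
    have h1 : ContDiffAt ℝ ∞ (fun b => (fderiv ℝ h (f b)).flip) a :=
      (flipₗᵢ ℝ E E (E →L[ℝ] ℝ)).contDiff.contDiffAt.comp a hd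
    exact (flipₗᵢ ℝ E E ℝ).contDiff.contDiffAt.comp a (h1.clm_apply hv) |>.clm_apply hw
  exact hi.clm_apply (((((hd.clm_apply hv).clm_apply hw).add
    ((hd.clm_apply hw).clm_apply hv)).sub hl).const_smul (1 / 2 : ℝ))

theorem differentiableAt_christoffel (hm : IsMetricOn h s) (hz : z ∈ s) (v w : E) :
    DifferentiableAt ℝ (fun z' => christoffel h z' v w) z :=
  (hm.contDiffAt_christoffel (f := fun z' => z') hz contDiffAt_id contDiffAt_const
    contDiffAt_const).differentiableAt (by simp)

theorem curvature_add_left (hm : IsMetricOn h s) (hz : z ∈ s) (u u' v w : E) :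
    curvature h z (u + u') v w = curvature h z u v w + curvature h z u' v w := by
  simp only [curvature, christoffel_add_left, map_add, christoffel_add_right]
  rw [fderiv_fun_add (hm.differentiableAt_christoffel hz _ _)
    (hm.differentiableAt_christoffel hz _ _)]
  simp only [add_apply]
  abel

theorem curvature_smul_left (hm : IsMetricOn h s) (hz : z ∈ s) (a : ℝ) (u v w : E) :
    curvature h z (a • u) v w = a • curvature h z u v w := by
  simp only [curvature, christoffel_smul_left, map_smul, christoffel_smul_right]
  rw [fderiv_fun_const_smul (hm.differentiableAt_christoffel hz _ _)]
  simp only [FunLike.coe_smul, Pi.smul_apply, smul_add, smul_sub]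

theorem curvature_add_right (hm : IsMetricOn h s) (hz : z ∈ s) (u v w w' : E) :
    curvature h z u v (w + w') = curvature h z u v w + curvature h z u v w' := by
  simp only [curvature, christoffel_add_right]
  rw [fderiv_fun_add (hm.differentiableAt_christoffel hz _ _)
    (hm.differentiableAt_christoffel hz _ _), fderiv_fun_add
    (hm.differentiableAt_christoffel hz _ _) (hm.differentiableAt_christoffel hz _ _)]
  simp only [add_apply]
  abel

theorem curvature_smul_right (hm : IsMetricOn h s) (hz : z ∈ s) (a : ℝ) (u v w : E) :
    curvature h z u v (a • w) = a • curvature h z u v w := by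
  simp only [curvature, christoffel_smul_right]
  rw [fderiv_fun_const_smul (hm.differentiableAt_christoffel hz _ _),
    fderiv_fun_const_smul (hm.differentiableAt_christoffel hz _ _)]
  simp only [FunLike.coe_smul, Pi.smul_apply, smul_add, smul_sub]

/-- The curvature as a multilinear map. -/
theorem exists_curvature_eq (hm : IsMetricOn h s) (hz : z ∈ s) :
    ∃ R : E →ₗ[ℝ] E →ₗ[ℝ] E →ₗ[ℝ] E, ∀ u v w, R u v w = curvature h z u v w :=
  ⟨{ toFun := fun u => LinearMap.mk₂ ℝ (fun v w => curvature h z u v w)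
        (fun v v' w => by
          rw [curvature_swap, hm.curvature_add_left hz, neg_add, ← curvature_swap,
            ← curvature_swap])
        (fun a v w => by
          rw [curvature_swap, hm.curvature_smul_left hz, ← smul_neg, ← curvature_swap])
        (hm.curvature_add_right hz u)
        (fun a v w => hm.curvature_smul_right hz a u v w)
     map_add' := fun u u' => by
       ext v w
       exact hm.curvature_add_left hz u u' v w
     map_smul' := fun a u => by
       ext v w
       exact hm.curvature_smul_left hz a u v w }, fun _ _ _ => rfl⟩

/-- As the connection is metric, `D_a D_b h(w,w) = 2 h(∇_a ∇_b w, w) + 2 h(∇_b w, ∇_a w)`. The left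
side is symmetric in `a, b`, so antisymmetrizing leaves `h(R(u,v)w, w) = 0`. -/
theorem apply_curvature_self (hm : IsMetricOn h s) (hz : z ∈ s) (u v w : E) :
    h z (curvature h z u v w) w = 0 := by
  set f : E → ℝ := fun z' => h z' w w with hf
  have hfd : ContDiffAt ℝ ∞ f z :=
    ((hm.contDiffAt hz).clm_apply contDiffAt_const).clm_apply contDiffAt_const
  have h2 (a b : E) : fderiv ℝ (fderiv ℝ f) z a b
      = 2 * (h z (christoffel h z a (christoffel h z b w)) w
        + h z (christoffel h z b w) (christoffel h z a w)
        + h z (fderiv ℝ (fun z' => christoffel h z' b w) z a) w) := by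
    have hd : DifferentiableAt ℝ (fderiv ℝ f) z :=
      (hfd.fderiv_right (m := ∞) (by simp)).differentiableAt (by simp)
    have e1 : fderiv ℝ (fderiv ℝ f) z a b = fderiv ℝ (fun z' => fderiv ℝ f z' b) z a := by
      rw [(hd.hasFDerivAt.clm_apply (hasFDerivAt_const b z)).fderiv]
      simp
    have e2 : fderiv ℝ (fun z' => fderiv ℝ f z' b) z
        = fderiv ℝ (fun z' => 2 * h z' (christoffel h z' b w) w) z := by
      apply Filter.EventuallyEq.fderiv_eq
      filter_upwards [hm.eventually_mem hz] with z' hz'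
      rw [hf, hm.fderiv_apply_apply hz', hm.fderiv_eq hz', hm.symm z' hz' w]
      ring
    have e3 := (((hm.differentiableAt hz).hasFDerivAt.clm_apply
      (hm.differentiableAt_christoffel hz b w).hasFDerivAt).clm_apply
      (hasFDerivAt_const w z)).const_mul 2
    rw [e1, e2, e3.fderiv]
    simp [hm.fderiv_eq hz]
    ring
  have hs : fderiv ℝ (fderiv ℝ f) z u v = fderiv ℝ (fderiv ℝ f) z v u :=
    ((hfd.of_le (m := 2) ENat.LEInfty.out).isSymmSndFDerivAt (by simp)).eq u v
  rw [h2, h2, hm.symm z hz (christoffel h z u w)] at hs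
  simp only [curvature, map_add, map_sub, add_apply, sub_apply]
  linarith

end IsMetricOn
end LocalMetric

/-! ### Algebraic curvature tensors and the constant curvature form. -/

namespace LocalMetric

open ContinuousLinearMap

/-- A tensor with the symmetries of a curvature tensor is determined by its sectional curvatures. -/
theorem eq_zero_of_curvature_symmetries {V : Type*} [AddCommGroup V] (T : V → V → V → V → ℝ)
    (add1 : ∀ u u' v w x, T (u + u') v w x = T u v w x + T u' v w x)
    (add3 : ∀ u v w w' x, T u v (w + w') x = T u v w x + T u v w' x)
    (swap12 : ∀ u v w x, T v u w x = -T u v w x)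
    (diag34 : ∀ u v w, T u v w w = 0)
    (add4 : ∀ u v w x x', T u v w (x + x') = T u v w x + T u v w x')
    (cyclic : ∀ u v w x, T u v w x + T v w u x + T w u v x = 0)
    (sec : ∀ u v, T u v v u = 0) (u v w x : V) : T u v w x = 0 := by
  have add2 (u v v' w x) : T u (v + v') w x = T u v w x + T u v' w x := by
    rw [swap12, add1, swap12 u v, swap12 u v']
    ring
  have swap34 (u v w x) : T u v x w = -T u v w x := by
    have := diag34 u v (w + x)
    rw [add3, add4, add4, diag34, diag34] at this
    linarith
  -- Pair symmetry: the four cyclic identities on `u, v, w, x`, combined by antisymmetry in each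
  -- pair.
  have pair (u v w x) : T u v w x = T w x u v := by
    have h1 := cyclic u v w x
    have h2 := cyclic v w x u
    have h3 := cyclic w x u v
    have h4 := cyclic x u v w
    have e1 := swap34 v w u x
    have e2 := swap34 w x u v
    have e3 := swap12 v x w u
    have e4 := swap34 v x u w
    have e5 := swap12 u w v x
    have e6 := swap34 u w v x
    have e7 := swap34 x u v w
    have e8 := swap34 u v w x
    linarith
  -- Polarization of `sec` in the outer variable. It makes `T` alternating in its first three
  -- arguments, so the cyclic sum becomes `3 T = 0`.
  have h23 (u v x) : T u v v x = 0 := by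
    have h := sec (u + x) v
    rw [add1, add4, add4, sec, sec] at h
    linarith [pair x v v u, swap12 u v x v, swap34 u v v x]
  have swap23 (u v w x) : T u w v x = -T u v w x := by
    have := h23 u (v + w) x
    rw [add2, add3, add3, h23, h23] at this
    linarith
  have h1 := cyclic u v w x
  have h2 := swap12 u v w x
  have h3 := swap23 v u w x
  have h4 := swap23 u w v x
  have h5 := swap12 w u v x
  have h6 := swap23 u v w x
  linarith

variable {E : Type*} [NormedAddCommGroup E] [NormedSpace ℝ E]

/-- On a line in the direction of a non-degenerate plane, almost all planes are non-degenerate. -/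
theorem dense_gram_ne_zero (h : E → E →L[ℝ] E →L[ℝ] ℝ) {z : E} (v w : E) {v₀ w₀ : E}
    (hsymm : ∀ v w, h z v w = h z w v) (h₀ : gram h z v₀ w₀ ≠ 0) :
    Dense {s : ℝ | gram h z (v + s • v₀) (w + s • w₀) ≠ 0} := by
  let q (b : Fin 5 → ℝ) : Polynomial ℝ :=
    .C (b 0) + .C (b 1) * .X + .C (b 2) * .X ^ 2 + .C (b 3) * .X ^ 3 + .C (b 4) * .X ^ 4
  let m := h z v w₀ + h z v₀ w
  -- The Gram determinant expanded in powers of `s`; its quartic coefficient `gram h z v₀ w₀` is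
  -- non-zero, so it has finitely many roots.
  let p : Polynomial ℝ := q ![gram h z v w,
    h z v v * (2 * h z w w₀) + 2 * h z v v₀ * h z w w - 2 * h z v w * m,
    h z v v * h z w₀ w₀ + 2 * h z v v₀ * (2 * h z w w₀) + h z v₀ v₀ * h z w w - m ^ 2
      - 2 * h z v w * h z v₀ w₀,
    2 * h z v v₀ * h z w₀ w₀ + h z v₀ v₀ * (2 * h z w w₀) - 2 * m * h z v₀ w₀,
    gram h z v₀ w₀]
  have hp (s : ℝ) : p.eval s = gram h z (v + s • v₀) (w + s • w₀) := by
    simp [p, q, m, gram, hsymm v₀ v, hsymm w₀ w]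
    ring
  have hp0 : p ≠ 0 := by
    intro e
    have hq (b : Fin 5 → ℝ) : (q b).coeff 4 = b 4 := by
      simp [q]
    have h4 : p.coeff 4 = gram h z v₀ w₀ := hq _
    exact h₀ (by rw [← h4, e, Polynomial.coeff_zero])
  have hf : {s : ℝ | p.eval s = 0}.Countable := by
    refine (p.roots.toFinset.finite_toSet.subset fun s hs => ?_).countable
    simpa [hp0] using hs
  refine (hf.dense_compl ℝ).mono fun s hs => ?_
  simpa [hp] using hs

variable [FiniteDimensional ℝ E] {h : E → E →L[ℝ] E →L[ℝ] ℝ} {s : Set E} {z : E}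

/-- Schur's form of the curvature tensor of a metric whose sectional curvatures at a point agree. -/
theorem IsMetricOn.curvature_eq_of_sectionalCurvature_eq (hm : IsMetricOn h s) (hz : z ∈ s) {k : ℝ}
    (hk : ∀ v w, gram h z v w ≠ 0 → sectionalCurvature h z v w = k)
    {v₀ w₀ : E} (h₀ : gram h z v₀ w₀ ≠ 0) (u v w : E) :
    curvature h z u v w = k • (h z v w • u - h z u w • v) := by
  obtain ⟨R, hR⟩ := hm.exists_curvature_eq hz
  -- Both sides are continuous along `(v + s • v₀, w + s • w₀)` and agree for a dense set of `s`,
  -- hence at `s = 0`, even if `v`, `w` span a degenerate plane.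
  have hsec (v w : E) : h z (R v w w) v = k * gram h z v w := by
    have hc : Continuous fun s : ℝ =>
        h z (R (v + s • v₀) (w + s • w₀) (w + s • w₀)) (v + s • v₀) := by
      simp only [map_add, map_smul, LinearMap.add_apply, LinearMap.smul_apply, add_apply,
        FunLike.coe_smul, Pi.smul_apply]
      fun_prop
    have hc' : Continuous fun s : ℝ => k * gram h z (v + s • v₀) (w + s • w₀) := by
      unfold gram
      fun_prop
    have := congrFun (hc.ext_on (dense_gram_ne_zero h v w (hm.symm z hz) h₀) hc' fun s hs => by
      dsimp only
      rw [← hk _ _ hs, sectionalCurvature, div_mul_cancel₀ _ hs, hR]) 0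
    simpa using this
  have key := eq_zero_of_curvature_symmetries
    (fun u v w x => h z (R u v w) x - k * (h z v w * h z u x - h z u w * h z v x))
    (fun u u' v w x => by simp; ring) (fun u v w w' x => by simp; ring)
    (fun u v w x => by simp [hR, curvature_swap h z u v]; ring)
    (fun u v w => by simp [hR, hm.apply_curvature_self hz]; right; ring)
    (fun u v w x x' => by simp; ring)
    (fun u v w x => by
      have := congrArg (fun y => h z y x) (hm.curvature_cyclic hz u v w)
      simp only [map_add, map_zero, add_apply, zero_apply] at this
      simp only [hR, hm.symm z hz w v, hm.symm z hz u w, hm.symm z hz v u]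
      linear_combination this)
    (fun u v => by
      simp only [hsec, gram, hm.symm z hz v u]
      ring)
  refine hm.eq_of_apply_eq hz fun x => ?_
  have := key u v w x
  simp only [hR] at this
  simp only [map_smul, map_sub, sub_apply, FunLike.coe_smul, Pi.smul_apply, smul_eq_mul]
  linarith

end LocalMetric

/-! ### The natural lift and its geometry along the zero section. -/

namespace LocalMetric

open ContinuousLinearMap Set

variable {E : Type*} [NormedAddCommGroup E] [NormedSpace ℝ E]

/-- `K` is, on the tangent bundle of the open set `s` of the vector space `E`, the general natural
lift of the metric `h` defined by the functions `c₁, …, d₃`. -/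
structure IsNaturalLiftOn (h : E → E →L[ℝ] E →L[ℝ] ℝ) (K : E × E → E × E →L[ℝ] E × E →L[ℝ] ℝ)
    (s : Set E) (c₁ c₂ c₃ d₁ d₂ d₃ : ℝ → ℝ) : Prop where
  contDiffOn_c₁ : ContDiffOn ℝ ∞ c₁ (Ici 0)
  contDiffOn_c₂ : ContDiffOn ℝ ∞ c₂ (Ici 0)
  contDiffOn_c₃ : ContDiffOn ℝ ∞ c₃ (Ici 0)
  contDiffOn_d₁ : ContDiffOn ℝ ∞ d₁ (Ici 0)
  contDiffOn_d₂ : ContDiffOn ℝ ∞ d₂ (Ici 0)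
  contDiffOn_d₃ : ContDiffOn ℝ ∞ d₃ (Ici 0)
  pos : ∀ x ∈ s, ∀ v, v ≠ 0 → 0 < h x v v
  horizontal_horizontal : ∀ x ∈ s, ∀ y v w,
    K (x, y) (horizontalFrame h x y v) (horizontalFrame h x y w)
      = c₁ ((1 / 2) * h x y y) * h x v w + d₁ ((1 / 2) * h x y y) * (h x y v * h x y w)
  vertical_vertical : ∀ x ∈ s, ∀ y v w, K (x, y) (verticalFrame v) (verticalFrame w)
      = c₂ ((1 / 2) * h x y y) * h x v w + d₂ ((1 / 2) * h x y y) * (h x y v * h x y w)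
  vertical_horizontal : ∀ x ∈ s, ∀ y v w, K (x, y) (verticalFrame v) (horizontalFrame h x y w)
      = c₃ ((1 / 2) * h x y y) * h x v w + d₃ ((1 / 2) * h x y y) * (h x y v * h x y w)
  horizontal_vertical : ∀ x ∈ s, ∀ y v w, K (x, y) (horizontalFrame h x y v) (verticalFrame w)
      = c₃ ((1 / 2) * h x y y) * h x v w + d₃ ((1 / 2) * h x y y) * (h x y v * h x y w)

namespace IsNaturalLiftOn

variable {h : E → E →L[ℝ] E →L[ℝ] ℝ} {K : E × E → E × E →L[ℝ] E × E →L[ℝ] ℝ} {s : Set E}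
  {c₁ c₂ c₃ d₁ d₂ d₃ : ℝ → ℝ} {x : E}

theorem energy_nonneg (hK : IsNaturalLiftOn h K s c₁ c₂ c₃ d₁ d₂ d₃) (hx : x ∈ s) (y : E) :
    0 ≤ (1 / 2) * h x y y := by
  rcases eq_or_ne y 0 with rfl | hy
  · simp
  · have := hK.pos x hx y hy
    positivity

/-- The lifted metric in the coordinates `(x, y)`. -/
theorem apply_eq (hK : IsNaturalLiftOn h K s c₁ c₂ c₃ d₁ d₂ d₃) (hx : x ∈ s)
    (y v v' w w' : E) :
    K (x, y) (v, v') (w, w')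
      = c₁ ((1 / 2) * h x y y) * h x v w + d₁ ((1 / 2) * h x y y) * (h x y v * h x y w)
      + (c₃ ((1 / 2) * h x y y) * h x v (w' + christoffel h x y w)
        + d₃ ((1 / 2) * h x y y) * (h x y v * h x y (w' + christoffel h x y w)))
      + (c₃ ((1 / 2) * h x y y) * h x (v' + christoffel h x y v) w
        + d₃ ((1 / 2) * h x y y) * (h x y (v' + christoffel h x y v) * h x y w))
      + (c₂ ((1 / 2) * h x y y) * h x (v' + christoffel h x y v) (w' + christoffel h x y w)
        + d₂ ((1 / 2) * h x y y) *
          (h x y (v' + christoffel h x y v) * h x y (w' + christoffel h x y w))) := by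
  have e (a a' : E) : (a, a')
      = horizontalFrame h x y a + verticalFrame (a' + christoffel h x y a) := by
    simp [horizontalFrame, verticalFrame]
  rw [e v v', e w w']
  simp only [map_add, add_apply]
  rw [hK.horizontal_horizontal x hx, hK.horizontal_vertical x hx, hK.vertical_horizontal x hx,
    hK.vertical_vertical x hx]
  simp only [map_add, add_apply]
  ring

theorem apply_zeroSection (hK : IsNaturalLiftOn h K s c₁ c₂ c₃ d₁ d₂ d₃) (hx : x ∈ s)
    (v v' w w' : E) :
    K (x, 0) (v, v') (w, w')
      = c₁ 0 * h x v w + c₃ 0 * (h x v w' + h x v' w) + c₂ 0 * h x v' w' := by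
  rw [hK.apply_eq hx]
  simp
  ring

/-- On the span of `(u,0)` and `(0,u)` the form `K (x, 0)` is `h x u u` times the matrix with rows
`(c₁ 0, c₃ 0)` and `(c₃ 0, c₂ 0)`. A kernel vector `(a, b)` of this matrix would make `(a • u, b •
u)` orthogonal to the whole tangent space. -/
theorem exists_gram_ne_zero (hK : IsNaturalLiftOn h K s c₁ c₂ c₃ d₁ d₂ d₃)
    (hnd : ∀ X, (∀ Y, K (x, 0) X Y = 0) → X = 0) (hx : x ∈ s) {u : E} (hu : u ≠ 0) :
    gram K (x, 0) (u, 0) (0, u) ≠ 0 := by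
  have hpos := hK.pos x hx u hu
  have hval : gram K (x, 0) (u, 0) (0, u) = (c₁ 0 * c₂ 0 - c₃ 0 ^ 2) * h x u u ^ 2 := by
    simp only [gram, hK.apply_zeroSection hx, map_zero, zero_apply]
    ring
  have hz (a b : ℝ) (h1 : c₁ 0 * a + c₃ 0 * b = 0) (h2 : c₃ 0 * a + c₂ 0 * b = 0) :
      a = 0 ∧ b = 0 := by
    have := hnd (a • u, b • u) <| by
      rintro ⟨w, w'⟩
      rw [hK.apply_zeroSection hx]
      simp only [map_smul, FunLike.coe_smul, Pi.smul_apply, smul_eq_mul]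
      linear_combination h x u w * h1 + h x u w' * h2
    simpa [hu] using this
  rw [hval]
  refine mul_ne_zero (fun hdet => ?_) (by positivity)
  -- If the determinant vanishes, the adjugate's columns lie in the kernel (up to sign), so all
  -- entries are zero; then `(1, 0)` is in the kernel too.
  obtain ⟨e2, e3⟩ := hz (c₂ 0) (-c₃ 0) (by linear_combination hdet) (by ring)
  obtain ⟨-, e1⟩ := hz (c₃ 0) (-c₁ 0) (by ring) (by linear_combination -hdet)
  rw [neg_eq_zero] at e1 e3
  have := hz 1 0 (by simp [e1]) (by simp [e3])
  simp at this

variable [FiniteDimensional ℝ E]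

/-- Smoothness of `K` is read off from the explicit formula `apply_eq`; invertibility is injectivity
plus equality of dimensions. -/
theorem isMetricOn (hK : IsNaturalLiftOn h K s c₁ c₂ c₃ d₁ d₂ d₃)
    (hm : IsMetricOn h s)
    (hnd : ∀ z ∈ s ×ˢ (univ : Set E), ∀ X, (∀ Y, K z X Y = 0) → X = 0) :
    IsMetricOn K (s ×ˢ univ) where
  isOpen := hm.isOpen.prod isOpen_univ
  contDiffOn := by
    rw [contDiffOn_clm_apply]
    rintro ⟨v, v'⟩
    rw [contDiffOn_clm_apply]
    rintro ⟨w, w'⟩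
    rintro ⟨x, y⟩ ⟨hx, -⟩
    apply ContDiffAt.contDiffWithinAt
    have hev : ∀ᶠ z : E × E in nhds (x, y), z.1 ∈ s :=
      continuous_fst.continuousAt.eventually (hm.eventually_mem hx)
    have h1 : ContDiffAt ℝ ∞ (fun z : E × E => z.1) (x, y) := contDiffAt_fst
    have h2 : ContDiffAt ℝ ∞ (fun z : E × E => z.2) (x, y) := contDiffAt_snd
    have hh {α β : E × E → E} (hα : ContDiffAt ℝ ∞ α (x, y)) (hβ : ContDiffAt ℝ ∞ β (x, y)) :
        ContDiffAt ℝ ∞ (fun z => h z.1 (α z) (β z)) (x, y) :=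
      (ContDiffAt.clm_apply (f := fun z : E × E => h z.1)
        ((hm.contDiffAt hx).comp (x, y) h1) hα).clm_apply hβ
    have hΓ (v v' : E) :
        ContDiffAt ℝ ∞ (fun z : E × E => v' + christoffel h z.1 z.2 v) (x, y) :=
      contDiffAt_const.add (hm.contDiffAt_christoffel hx h1 h2 contDiffAt_const)
    -- At `y = 0` the energy is the endpoint of `[0, ∞)`, where `c` is smooth only from one side.
    -- This suffices because the energy never becomes negative.
    have hc {c : ℝ → ℝ} (hc : ContDiffOn ℝ ∞ c (Ici 0)) :
        ContDiffAt ℝ ∞ (fun z : E × E => c ((1 / 2) * h z.1 z.2 z.2)) (x, y) := by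
      have ht : ContDiffWithinAt ℝ ∞ (fun z : E × E => (1 / 2) * h z.1 z.2 z.2)
          {z : E × E | z.1 ∈ s} (x, y) := (contDiffAt_const.mul (hh h2 h2)).contDiffWithinAt
      refine ContDiffWithinAt.contDiffAt (s := {z : E × E | z.1 ∈ s}) ?_ hev
      exact (hc _ (hK.energy_nonneg hx y)).comp (x, y) ht fun z hz => hK.energy_nonneg hz z.2
    have hcst (a : E) : ContDiffAt ℝ ∞ (fun _ : E × E => a) (x, y) := contDiffAt_const
    have key := (((hc hK.contDiffOn_c₁).mul (hh (hcst v) (hcst w))).add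
        ((hc hK.contDiffOn_d₁).mul ((hh h2 (hcst v)).mul (hh h2 (hcst w))))).add
      (((hc hK.contDiffOn_c₃).mul (hh (hcst v) (hΓ w w'))).add
        ((hc hK.contDiffOn_d₃).mul ((hh h2 (hcst v)).mul (hh h2 (hΓ w w'))))) |>.add
      (((hc hK.contDiffOn_c₃).mul (hh (hΓ v v') (hcst w))).add
        ((hc hK.contDiffOn_d₃).mul ((hh h2 (hΓ v v')).mul (hh h2 (hcst w))))) |>.add
      (((hc hK.contDiffOn_c₂).mul (hh (hΓ v v') (hΓ w w'))).add
        ((hc hK.contDiffOn_d₂).mul ((hh h2 (hΓ v v')).mul (hh h2 (hΓ w w')))))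
    refine key.congr_of_eventuallyEq ?_
    filter_upwards [hev] with z hz using hK.apply_eq hz z.2 v v' w w'
  symm := by
    rintro ⟨x, y⟩ ⟨hx, -⟩ ⟨v, v'⟩ ⟨w, w'⟩
    rw [hK.apply_eq hx, hK.apply_eq hx, hm.symm x hx w v, hm.symm x hx w (v' + _),
      hm.symm x hx (w' + _) v, hm.symm x hx (w' + _) (v' + _)]
    ring
  isInvertible := fun z hz => by
    have hinj : Function.Injective (K z : E × E →ₗ[ℝ] E × E →L[ℝ] ℝ) :=
      (injective_iff_map_eq_zero _).2 fun X hX => hnd z hz X fun Y => by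
        have : K z X = 0 := hX
        simp [this]
    have hr : Module.finrank ℝ (E × E) = Module.finrank ℝ (E × E →L[ℝ] ℝ) := by
      rw [← LinearMap.toContinuousLinearMap (𝕜 := ℝ) (E := E × E) (F' := ℝ) |>.finrank_eq]
      exact Subspace.dual_finrank_eq.symm
    exact ⟨(LinearEquiv.ofInjectiveOfFinrankEq _ hinj hr).toContinuousLinearEquiv, rfl⟩

/-- First derivatives of the lifted metric along the zero section. -/
theorem fderiv_zeroSection (hK : IsNaturalLiftOn h K s c₁ c₂ c₃ d₁ d₂ d₃)
    (hm : IsMetricOn h s) (hmK : IsMetricOn K (s ×ˢ univ)) (hx : x ∈ s) (p q v v' w w' : E) :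
    fderiv ℝ K (x, 0) (p, q) (v, v') (w, w')
      = c₁ 0 * fderiv ℝ h x p v w
      + c₃ 0 * (fderiv ℝ h x p v w' + fderiv ℝ h x p v' w
        + h x v (christoffel h x q w) + h x (christoffel h x q v) w)
      + c₂ 0 * (fderiv ℝ h x p v' w'
        + h x v' (christoffel h x q w) + h x (christoffel h x q v) w') := by
  have hline : HasDerivAt (fun r : ℝ => x + r • p) p 0 := by
    simpa using ((hasDerivAt_id (0 : ℝ)).smul_const p).const_add x
  have hlq : HasDerivAt (fun r : ℝ => r • q) q 0 := by
    simpa using (hasDerivAt_id (0 : ℝ)).smul_const q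
  have hx0 : x + (0 : ℝ) • p = x := by simp
  have hev : ∀ᶠ r : ℝ in nhds 0, x + r • p ∈ s :=
    hline.continuousAt.eventually (by simpa using hm.eventually_mem hx)
  have hh {α β : ℝ → E} {α' β' : E} (hα : HasDerivAt α α' 0) (hβ : HasDerivAt β β' 0) :
      HasDerivAt (fun r => h (x + r • p) (α r) (β r))
        (fderiv ℝ h x p (α 0) (β 0) + h x α' (β 0) + h x (α 0) β') 0 := by
    have h0 : HasDerivAt (fun r : ℝ => h (x + r • p)) (fderiv ℝ h x p) 0 :=
      HasFDerivAt.comp_hasDerivAt (0 : ℝ) (l := h) (f := fun r : ℝ => x + r • p)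
        (by rw [hx0]; exact (hm.differentiableAt hx).hasFDerivAt) hline
    simpa using (h0.clm_apply hα).clm_apply hβ
  -- By linearity the Christoffel term is `r` times a differentiable function, so no derivative of
  -- it survives at `r = 0`.
  have hΓ (a a' : E) : HasDerivAt (fun r : ℝ => a' + christoffel h (x + r • p) (r • q) a)
      (christoffel h x q a) 0 := by
    have hd : DifferentiableAt ℝ (fun r : ℝ => christoffel h (x + r • p) q a) 0 :=
      DifferentiableAt.comp (0 : ℝ) (g := fun z => christoffel h z q a)
        (by rw [hx0]; exact hm.differentiableAt_christoffel hx q a) hline.differentiableAt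
    have := ((hasDerivAt_id (0 : ℝ)).smul hd.hasDerivAt).const_add a'
    simpa [christoffel_smul_left] using this
  have ht := (hh hlq hlq).const_mul (1 / 2)
  -- The energy is quadratic in `r • q`, so its derivative at `r = 0` vanishes and the one-sided
  -- derivative of `c` drops out.
  have hc {c : ℝ → ℝ} (hc : ContDiffOn ℝ ∞ c (Ici 0)) :
      HasDerivAt (fun r : ℝ => c ((1 / 2) * h (x + r • p) (r • q) (r • q))) 0 0 := by
    have h0 : HasDerivWithinAt c (derivWithin c (Ici 0) 0) (Ici 0) 0 :=
      ((hc 0 self_mem_Ici).differentiableWithinAt (by simp)).hasDerivWithinAt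
    have h1 := HasDerivWithinAt.comp (h₂ := c) (s' := Ici 0)
      (h := fun r : ℝ => (1 / 2) * h (x + r • p) (r • q) (r • q)) (0 : ℝ)
      (by simp only [zero_smul, map_zero, mul_zero]; exact h0)
      (ht.hasDerivWithinAt (s := {r : ℝ | x + r • p ∈ s}))
      (fun r hr => hK.energy_nonneg hr (r • q))
    exact (h1.hasDerivAt hev).congr_deriv (by simp)
  have hcst (a : E) : HasDerivAt (fun _ : ℝ => a) 0 0 := hasDerivAt_const 0 a
  have key := (((hc hK.contDiffOn_c₁).mul (hh (hcst v) (hcst w))).add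
        ((hc hK.contDiffOn_d₁).mul ((hh hlq (hcst v)).mul (hh hlq (hcst w))))).add
      (((hc hK.contDiffOn_c₃).mul (hh (hcst v) (hΓ w w'))).add
        ((hc hK.contDiffOn_d₃).mul ((hh hlq (hcst v)).mul (hh hlq (hΓ w w'))))) |>.add
      (((hc hK.contDiffOn_c₃).mul (hh (hΓ v v') (hcst w))).add
        ((hc hK.contDiffOn_d₃).mul ((hh hlq (hΓ v v')).mul (hh hlq (hcst w))))) |>.add
      (((hc hK.contDiffOn_c₂).mul (hh (hΓ v v') (hΓ w w'))).add
        ((hc hK.contDiffOn_d₂).mul ((hh hlq (hΓ v v')).mul (hh hlq (hΓ w w')))))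
  have hKd : HasDerivAt (fun r : ℝ => K (x + r • p, r • q) (v, v') (w, w'))
      (fderiv ℝ K (x, 0) (p, q) (v, v') (w, w')) 0 := by
    have h0 : HasDerivAt (fun r : ℝ => K (x + r • p, r • q)) (fderiv ℝ K (x, 0) (p, q)) 0 :=
      HasFDerivAt.comp_hasDerivAt (0 : ℝ) (l := K) (f := fun r : ℝ => (x + r • p, r • q))
        (by simpa using (hmK.differentiableAt (z := (x, 0)) ⟨hx, mem_univ _⟩).hasFDerivAt)
        (hline.prodMk hlq)
    simpa using (h0.clm_apply (hasDerivAt_const 0 (v, v'))).clm_apply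
      (hasDerivAt_const 0 (w, w'))
  refine (hKd.unique (key.congr_of_eventuallyEq ?_)).trans ?_
  · filter_upwards [hev] with r hr using hK.apply_eq hr (r • q) v v' w w'
  simp only [Pi.mul_apply, christoffel_zero_left, zero_smul, map_zero, zero_apply,
    mul_zero, zero_mul, zero_add, add_zero]
  ring

/-- In the Koszul formula tested on `(a, b)`, the `c₁` terms are absent, and the others reduce to `2
c₃ h(Γ(u,w), a) + 2 c₂ h(Γ(u,w), b)` because the base connection is metric and torsion-free. -/
theorem christoffel_zeroSection (hK : IsNaturalLiftOn h K s c₁ c₂ c₃ d₁ d₂ d₃)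
    (hm : IsMetricOn h s) (hmK : IsMetricOn K (s ×ˢ univ)) (hx : x ∈ s) (u w : E) :
    christoffel K (x, 0) (u, 0) (0, w) = (0, christoffel h x u w) := by
  refine hmK.christoffel_eq ⟨hx, mem_univ _⟩ ?_
  rintro ⟨a, b⟩
  rw [hK.fderiv_zeroSection hm hmK hx, hK.fderiv_zeroSection hm hmK hx,
    hK.fderiv_zeroSection hm hmK hx, hK.apply_zeroSection hx]
  simp only [christoffel_zero_left, christoffel_zero_right, map_zero, zero_apply,
    mul_zero, zero_add, add_zero, hm.fderiv_eq hx]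
  simp only [hm.christoffel_symm hx a, hm.christoffel_symm hx b, hm.christoffel_symm hx w u,
    hm.symm x hx w]
  ring

/-- Along the zero section, the lifted curvature operator of a horizontal plane acts on vertical
vectors as the curvature operator of the base. -/
theorem curvature_zeroSection (hK : IsNaturalLiftOn h K s c₁ c₂ c₃ d₁ d₂ d₃)
    (hm : IsMetricOn h s) (hmK : IsMetricOn K (s ×ˢ univ)) (hx : x ∈ s) (u v w : E) :
    curvature K (x, 0) (u, 0) (v, 0) (0, w) = (0, curvature h x u v w) := by
  -- The direction `(u, 0)` is tangent to the zero section, so the values of the Christoffel map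
  -- there determine this derivative.
  have key (u v : E) : fderiv ℝ (fun z => christoffel K z (v, 0) (0, w)) (x, 0) (u, 0)
      = (0, fderiv ℝ (fun z => christoffel h z v w) x u) := by
    have hd := (hmK.differentiableAt_christoffel (z := (x, 0)) ⟨hx, mem_univ _⟩
      (v, 0) (0, w)).hasFDerivAt
    have h1 := hd.comp (f := fun z : E => (z, (0 : E))) x
      ((hasFDerivAt_id x).prodMk (hasFDerivAt_const (0 : E) x))
    have h2 := (hasFDerivAt_const (0 : E) x).prodMk
      (hm.differentiableAt_christoffel hx v w).hasFDerivAt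
    have h3 : ((fun z => christoffel K z (v, 0) (0, w)) ∘ fun z : E => (z, (0 : E)))
        =ᶠ[nhds x] fun z => (0, christoffel h z v w) := by
      filter_upwards [hm.eventually_mem hx] with z hz
        using hK.christoffel_zeroSection hm hmK hz v w
    have := congrArg (fun L => L u) (h1.unique (h2.congr_of_eventuallyEq h3))
    simpa using this
  simp only [curvature, key, hK.christoffel_zeroSection hm hmK hx]
  simp

/-- If the lifted metric has constant sectional curvature, the base metric is flat. -/
theorem curvature_eq_zero (hK : IsNaturalLiftOn h K s c₁ c₂ c₃ d₁ d₂ d₃)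
    (hm : IsMetricOn h s)
    (hnd : ∀ z ∈ s ×ˢ (univ : Set E), ∀ X, (∀ Y, K z X Y = 0) → X = 0) {k : ℝ} (hx : x ∈ s)
    (hk : ∀ v w, gram K (x, 0) v w ≠ 0 → sectionalCurvature K (x, 0) v w = k) (u v w : E) :
    curvature h x u v w = 0 := by
  have hmK := hK.isMetricOn hm hnd
  have hz : (x, (0 : E)) ∈ s ×ˢ (univ : Set E) := ⟨hx, mem_univ _⟩
  rcases subsingleton_or_nontrivial E with hE | hE
  · exact Subsingleton.elim _ _
  · obtain ⟨e, he⟩ := exists_ne (0 : E)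
    have := hmK.curvature_eq_of_sectionalCurvature_eq hz hk
      (hK.exists_gram_ne_zero (hnd _ hz) hx he) (u, 0) (v, 0) (0, w)
    rw [hK.curvature_zeroSection hm hmK hx] at this
    -- The right side is a combination of `(u, 0)` and `(v, 0)`.
    simpa using congrArg Prod.snd this

end IsNaturalLiftOn
end LocalMetric

/-! ### Passage from the manifold to charts. -/

open Set

section Charts

variable {E : Type*} [NormedAddCommGroup E] [NormedSpace ℝ E]
  {H : Type*} [TopologicalSpace H] {I : ModelWithCorners ℝ E H}
  {N : Type*} [TopologicalSpace N] [ChartedSpace H N]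

theorem metricInChart_apply (B : ∀ q : N, TangentSpace I q →L[ℝ] TangentSpace I q →L[ℝ] ℝ)
    (p : N) (z v w : E) :
    metricInChart I B p z v w = B ((extChartAt I p).symm z)
      (mfderiv 𝓘(ℝ, E) I (extChartAt I p).symm z v)
      (mfderiv 𝓘(ℝ, E) I (extChartAt I p).symm z w) :=
  rfl

variable [I.Boundaryless] [IsManifold I 1 N]

theorem isInvertible_mfderiv_extChartAt_symm {p : N} {z : E} (hz : z ∈ (extChartAt I p).target) :
    (mfderiv 𝓘(ℝ, E) I (extChartAt I p).symm z).IsInvertible := by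
  have := isInvertible_mfderivWithin_extChartAt_symm hz
  rwa [I.range_eq_univ, mfderivWithin_univ] at this

theorem metricInChart_nondegenerate
    {B : ∀ q : N, TangentSpace I q →L[ℝ] TangentSpace I q →L[ℝ] ℝ}
    (hB : ∀ (q : N) (X : TangentSpace I q), (∀ Y : TangentSpace I q, B q X Y = 0) → X = 0)
    {p : N} {z : E} (hz : z ∈ (extChartAt I p).target) {X : E}
    (hX : ∀ Y, metricInChart I B p z X Y = 0) : X = 0 := by
  have hi := isInvertible_mfderiv_extChartAt_symm hz
  have h0 : mfderiv 𝓘(ℝ, E) I (extChartAt I p).symm z X = 0 := hB _ _ fun Y => by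
    obtain ⟨Y, rfl⟩ := hi.surjective Y
    exact hX Y
  exact hi.injective (h0.trans (map_zero _).symm)

end Charts

section Riemannian

variable {E : Type*} [NormedAddCommGroup E] [NormedSpace ℝ E]
  {M : Type*} [TopologicalSpace M] [ChartedSpace E M] [IsManifold 𝓘(ℝ, E) ∞ M]
  (g : Bundle.ContMDiffRiemannianMetric 𝓘(ℝ, E) ∞ E (fun x : M => TangentSpace 𝓘(ℝ, E) x))

theorem metricInChart_pos {p : M} {z : E} (hz : z ∈ (extChartAt 𝓘(ℝ, E) p).target) {v : E}
    (hv : v ≠ 0) : 0 < metricInChart 𝓘(ℝ, E) g.inner p z v v := by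
  have hi := isInvertible_mfderiv_extChartAt_symm hz
  rw [metricInChart_apply]
  exact g.pos _ _ fun h0 => hv (hi.injective (Eq.trans h0 (ContinuousLinearMap.map_zero _).symm))

/-- The coordinate vector fields of a chart are smooth. -/
theorem contMDiffOn_mfderiv_extChartAt_symm (p : M) (v : E) :
    ContMDiffOn 𝓘(ℝ, E) 𝓘(ℝ, E).tangent ∞
      (fun z => (⟨(extChartAt 𝓘(ℝ, E) p).symm z,
        mfderiv 𝓘(ℝ, E) 𝓘(ℝ, E) (extChartAt 𝓘(ℝ, E) p).symm z v⟩ : TangentBundle 𝓘(ℝ, E) M))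
      (extChartAt 𝓘(ℝ, E) p).target := by
  have ho := isOpen_extChartAt_target (I := 𝓘(ℝ, E)) p
  have h1 := (contMDiffOn_extChartAt_symm (I := 𝓘(ℝ, E)) (n := ∞) p).contMDiffOn_tangentMapWithin
    (m := ∞) (by simp) ho.uniqueMDiffOn
  have h2 : ContMDiff 𝓘(ℝ, E) 𝓘(ℝ, E).tangent ∞ (fun z : E => (⟨z, v⟩ :
      TangentBundle 𝓘(ℝ, E) E)) := by
    exact contMDiff_vectorSpace_iff_contDiff.2 contDiff_const
  refine (h1.comp h2.contMDiffOn (fun z hz => hz)).congr fun z hz => ?_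
  simp only [Function.comp, tangentMapWithin]
  rw [mfderivWithin_of_isOpen ho hz]

theorem metricInChart_symm (p : M) (z v w : E) :
    metricInChart 𝓘(ℝ, E) g.inner p z v w = metricInChart 𝓘(ℝ, E) g.inner p z w v := by
  rw [metricInChart_apply, metricInChart_apply]
  exact g.symm _ _ _

variable [FiniteDimensional ℝ E]

/-- Smooth components come from applying `g` to smooth coordinate fields, invertibility from
positive definiteness. -/
theorem isMetricOn_metricInChart (p : M) :
    LocalMetric.IsMetricOn (metricInChart 𝓘(ℝ, E) g.inner p) (extChartAt 𝓘(ℝ, E) p).target where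
  isOpen := isOpen_extChartAt_target p
  contDiffOn := by
    rw [contDiffOn_clm_apply]
    intro v
    rw [contDiffOn_clm_apply]
    intro w
    have hg := g.contMDiff.comp_contMDiffOn
      (contMDiffOn_extChartAt_symm (I := 𝓘(ℝ, E)) (n := ∞) p)
    have := ContMDiffOn.clm_bundle_apply₂ (F₁ := E) (F₂ := E) (F₃ := ℝ)
      (E₁ := fun x : M => TangentSpace 𝓘(ℝ, E) x) (E₂ := fun x : M => TangentSpace 𝓘(ℝ, E) x)
      (E₃ := Bundle.Trivial M ℝ) hg (contMDiffOn_mfderiv_extChartAt_symm p v)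
      (contMDiffOn_mfderiv_extChartAt_symm p w)
    intro z hz
    have h1 := ((Bundle.contMDiffWithinAt_totalSpace).1 (this z hz)).2
    exact contMDiffWithinAt_iff_contDiffWithinAt.1 h1
  symm z _ := metricInChart_symm g p z
  isInvertible z hz := by
    have hinj : Function.Injective (metricInChart 𝓘(ℝ, E) g.inner p z : E →ₗ[ℝ] E →L[ℝ] ℝ) :=
      (injective_iff_map_eq_zero _).2 fun v hv => by
        by_contra h0
        have e : metricInChart 𝓘(ℝ, E) g.inner p z v = 0 := hv
        simpa [e] using metricInChart_pos g hz h0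
    have hr : Module.finrank ℝ E = Module.finrank ℝ (E →L[ℝ] ℝ) := by
      rw [← LinearMap.toContinuousLinearMap (𝕜 := ℝ) (E := E) (F' := ℝ) |>.finrank_eq]
      exact Subspace.dual_finrank_eq.symm
    exact ⟨(LinearEquiv.ofInjectiveOfFinrankEq _ hinj hr).toContinuousLinearEquiv, rfl⟩

end Riemannian

theorem proposition1
    {E : Type*} [NormedAddCommGroup E] [NormedSpace ℝ E] [FiniteDimensional ℝ E]
    {M : Type*} [TopologicalSpace M] [ChartedSpace E M] [IsManifold 𝓘(ℝ, E) ∞ M]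
    (g : Bundle.ContMDiffRiemannianMetric 𝓘(ℝ, E) ∞ E (fun x : M => TangentSpace 𝓘(ℝ, E) x))
    (G : ∀ a : TangentBundle 𝓘(ℝ, E) M,
      TangentSpace (𝓘(ℝ, E).tangent) a →L[ℝ] TangentSpace (𝓘(ℝ, E).tangent) a →L[ℝ] ℝ)
    (hG : ∀ (a : TangentBundle 𝓘(ℝ, E) M) (X : TangentSpace (𝓘(ℝ, E).tangent) a),
      (∀ Y : TangentSpace (𝓘(ℝ, E).tangent) a, G a X Y = 0) → X = 0)
    (hlift : IsGeneralNaturalLift g G)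
    (hconst : HasConstantSectionalCurvature (𝓘(ℝ, E).tangent) G) :
    IsFlatMetric 𝓘(ℝ, E) g.inner := by
  intro p x hx u v w
  obtain ⟨k, hk⟩ := hconst
  obtain ⟨c₁, c₂, c₃, d₁, d₂, d₃, hc₁, hc₂, hc₃, hd₁, hd₂, hd₃, h⟩ := hlift
  -- Any vector over `p` would serve: the induced chart depends only on the base point and covers
  -- all fibres over the chart of `M`.
  set a : TangentBundle 𝓘(ℝ, E) M := ⟨p, 0⟩
  have htarget : (extChartAt 𝓘(ℝ, E).tangent a).target
      = (extChartAt 𝓘(ℝ, E) p).target ×ˢ univ := by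
    rw [FiberBundle.extChartAt_target]
    congr 1
    refine inter_eq_left.2 fun z hz => ?_
    simpa using (extChartAt 𝓘(ℝ, E) p).map_target hz
  have hK : LocalMetric.IsNaturalLiftOn (metricInChart 𝓘(ℝ, E) g.inner p)
      (metricInChart 𝓘(ℝ, E).tangent G a) (extChartAt 𝓘(ℝ, E) p).target c₁ c₂ c₃ d₁ d₂ d₃ :=
    { contDiffOn_c₁ := hc₁
      contDiffOn_c₂ := hc₂
      contDiffOn_c₃ := hc₃
      contDiffOn_d₁ := hd₁
      contDiffOn_d₂ := hd₂
      contDiffOn_d₃ := hd₃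
      pos := fun z hz v hv => metricInChart_pos g hz hv
      horizontal_horizontal := fun z hz y v w => (h a z hz y v w).1
      vertical_vertical := fun z hz y v w => (h a z hz y v w).2.1
      vertical_horizontal := fun z hz y v w => (h a z hz y v w).2.2.1
      horizontal_vertical := fun z hz y v w => (h a z hz y v w).2.2.2 }
  exact hK.curvature_eq_zero (isMetricOn_metricInChart g p)
    (fun z hz X hX => metricInChart_nondegenerate hG (htarget ▸ hz) hX) hx
    (hk a (x, 0) (htarget ▸ ⟨hx, mem_univ _⟩)) u v w
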